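/- Let $\mathbb K$ be a non-archimedean local field (a locally compact, non-discrete, totally disconnected topological field), with absolute value $|\cdot|$ normalized by $d(\alpha x)=|\alpha|\,dx$ for $\alpha\neq0$ and $|0|=0$. Put $\mathfrak D=\{x:|x|\le 1\}$, $\mathfrak P=\{x:|x|<1\}$ and $\mathfrak P^{-1}=\{x: x\mathfrak P\subseteq\mathfrak D\}$. Let $dx$ be the Haar measure on $(\mathbb K,+)$ with $\int_{\mathfrak D}dx=1$, and let $\chi$ be a continuous unitary character of $(\mathbb K,+)$ that is trivial on $\mathfrak D$ and nontrivial on $\mathfrak P^{-1}$. Let $\hat g$ denote the Fourier transform of $g\in L^2(\mathbb K)$, that is, the continuous extension to $L^2(\mathbb K)$ of $\hat g(\xi)=\int_{\mathbb K} g(x)\chi(-\xi x)\,dx$, $g\in L^1(\mathbb K)\cap L^2(\mathbb K)$. Let $\psi\in L^2(\mathbb K)$, $\psi\ne 0$, be an admissible wavelet, i.e. $$c_\psi=\int_{\mathbb K}\frac{|\hat\psi(\xi)|^2}{|\xi|}\,d\xi<\infty .$$ For $a,b\in\mathbb K$, $a\ne0$, put $\psi_{a,b}(x)=|a|^{-1/2}\,\psi\big(\tfrac{x-b}{a}\big)$,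 and for $f\in L^2(\mathbb K)$ put $K_\psi f(a,b)=\int_{\mathbb K} f(x)\overline{\psi_{a,b}(x)}\,dx$. **Theorem (Inversion Formula).** For every $f\in L^2(\mathbb K)$, $$f(x)=\frac1{c_\psi}\int_{\mathbb K}\int_{\mathbb K}K_\psi f(a,b)\,\psi_{a,b}(x)\,\frac{da\,db}{|a|^2}$$ in the weak sense: for every $h\in L^2(\mathbb K)$ the function $(a,b)\mapsto\int_{\mathbb K}K_\psi f(a,b)\,\psi_{a,b}(x)\,\overline{h(x)}\,dx$ is integrable on $\mathbb K\times\mathbb K$ with respect to $\frac{da\,db}{|a|^2}$, and $$\int_{\mathbb K}f(x)\overline{h(x)}\,dx=\frac1{c_\psi}\int_{\mathbb K}\int_{\mathbb K}\left(\int_{\mathbb K}K_\psi f(a,b)\,\psi_{a,b}(x)\,\overline{h(x)}\,dx\right)\frac{da\,db}{|a|^2}.$$ -/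

import Mathlib

open MeasureTheory Filter Topology
open scoped ENNReal NNReal ComplexConjugate

noncomputable section

namespace LocalFieldWavelet

section AbsoluteValue

variable {K : Type*} [Field K] [TopologicalSpace K] [IsTopologicalRing K] [LocallyCompactSpace K]

open Classical in
/-- The normalized absolute value of a locally compact field: `d(αx) = |α| dx` for a (any)
additive Haar measure `dx` if `α ≠ 0`, and `|0| = 0`. -/
def absVal (α : K) : ℝ≥0 :=
  if h : α = 0 then 0 else distribHaarChar K (Units.mk0 α h)

variable (K) in
/-- The ring of integers `𝔇 = {x : |x| ≤ 1}`. -/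
def integers : Set K := {x | absVal x ≤ 1}

variable (K) in
/-- The prime ideal `𝔓 = {x : |x| < 1}`. -/
def primeIdeal : Set K := {x | absVal x < 1}

variable (K) in
/-- The fractional ideal `𝔓⁻¹ = {x : x 𝔓 ⊆ 𝔇}`. -/
def primeIdealInv : Set K := {x | ∀ y ∈ primeIdeal K, x * y ∈ integers K}

end AbsoluteValue

section Fourier

variable {K : Type*} [Field K] [MeasurableSpace K]

/-- `g` is an `L²` Fourier transform of `f`: it is the `L²` limit of the Fourier integrals
`ξ ↦ ∫ uₙ(x) χ(-ξx) dx` of some sequence `uₙ` in `L¹ ∩ L²` that converges to `f` in `L²`. -/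
def IsFourierL2 (χ : AddChar K Circle) (μ : Measure K) (f g : K → ℂ) : Prop :=
  MemLp g 2 μ ∧ ∃ u : ℕ → K → ℂ,
    (∀ n, Integrable (u n) μ ∧ MemLp (u n) 2 μ) ∧
    Tendsto (fun n => eLpNorm (u n - f) 2 μ) atTop (𝓝 0) ∧
    Tendsto (fun n => eLpNorm (Fourier.fourierIntegral χ μ (u n) - g) 2 μ) atTop (𝓝 0)

open Classical in
/-- The Fourier transform on `L²`, the continuous extension of the Fourier integral from
`L¹ ∩ L²`. As for any element of `L²`, its values are determined almost everywhere only; the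
value `0` is a convention for functions that have no Fourier transform in this sense. -/
def fourierL2 (χ : AddChar K Circle) (μ : Measure K) (f : K → ℂ) : K → ℂ :=
  if h : ∃ g, IsFourierL2 χ μ f g then h.choose else 0

end Fourier

section Wavelet

variable {K : Type*} [Field K] [TopologicalSpace K] [IsTopologicalRing K] [LocallyCompactSpace K]
  [MeasurableSpace K]

/-- The constant `c_ψ = ∫ |ψ̂(ξ)|² / |ξ| dξ`, possibly infinite. -/
def admissibilityConst (χ : AddChar K Circle) (μ : Measure K) (ψ : K → ℂ) : ℝ≥0∞ :=
  ∫⁻ ξ, ‖fourierL2 χ μ ψ ξ‖ₑ ^ 2 / (absVal ξ : ℝ≥0∞) ∂μ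

/-- Admissible wavelets: `ψ ∈ L²` and `c_ψ < ∞`. -/
structure IsAdmissible (χ : AddChar K Circle) (μ : Measure K) (ψ : K → ℂ) : Prop where
  memLp : MemLp ψ 2 μ
  const_lt_top : admissibilityConst χ μ ψ < ∞

/-- The daughter wavelet `ψ_{a,b}(x) = |a|^{-1/2} ψ((x - b) / a)`, for `a ≠ 0`. -/
def daughter (ψ : K → ℂ) (a b x : K) : ℂ :=
  ((1 / Real.sqrt (absVal a : ℝ) : ℝ) : ℂ) * ψ ((x - b) / a)

/-- The continuous wavelet transform `K_ψ f(a,b) = ∫ f(x) conj(ψ_{a,b}(x)) dx`. -/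
def cwt (μ : Measure K) (ψ f : K → ℂ) (a b : K) : ℂ :=
  ∫ x, f x * conj (daughter ψ a b x) ∂μ

/-- The measure `da db / |a|²` on `K × K`. (The set `a = 0` is null for `da db`.) -/
def scaleMeasure (μ : Measure K) : Measure (K × K) :=
  (μ.prod μ).withDensity fun p => (((absVal p.1 ^ 2)⁻¹ : ℝ≥0) : ℝ≥0∞)

end Wavelet

end LocalFieldWavelet

end


/-!
By Plancherel's theorem, `b ↦ K_ψ f(a, b)` is, up to the sign of `b` and the factor `|a|^{1/2}`,
the Fourier transform of `ξ ↦ f̂(ξ) conj(ψ̂(aξ))`. Plancherel's theorem once more, followed by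
Tonelli's theorem and the invariance of `da / |a|` under `a ↦ aξ`, gives
`‖K_ψ f‖² = ∫ |f̂(ξ)|² ∫ |ψ̂(aξ)|² da / |a| dξ = c_ψ ‖f‖²`, and polarization gives the theorem.

The only arithmetic input is Plancherel's theorem, that is, the self-duality of `dx`. It rests on
`𝔇` being its own annihilator, so that `1_𝔇` is its own Fourier transform. For the autocorrelation
`v` of `u`, with `v̂ = |û|²` and `v(0) = ‖u‖²`, the integral of `v̂` over `a⁻¹𝔇` equals
`∫_𝔇 v(at) dt`, and letting `a → 0` yields `‖û‖² = v(0)`.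
-/

namespace LocalFieldWavelet

section SquareIntegrable

variable {α β 𝕜 E F : Type*} [MeasurableSpace α] [MeasurableSpace β]
  {μ : Measure α} {ν : Measure β} [RCLike 𝕜]

theorem eLpNorm_two_sq [ENorm E] (f : α → E) :
    eLpNorm f 2 μ ^ 2 = ∫⁻ x, ‖f x‖ₑ ^ 2 ∂μ := by
  simpa only [NNReal.coe_ofNat, ENNReal.coe_ofNat, ENNReal.rpow_ofNat] using
    eLpNorm_nnreal_pow_eq_lintegral (f := f) (μ := μ) (p := 2) two_ne_zero

theorem integrable_mul_conj {f g : α → 𝕜} (hf : MemLp f 2 μ) (hg : MemLp g 2 μ) :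
    Integrable (fun x => f x * conj (g x)) μ :=
  hf.integrable_mul hg.star

theorem inner_eq_mul_inner_of_norm_add_smul_sq [NormedAddCommGroup E] [InnerProductSpace 𝕜 E]
    [NormedAddCommGroup F] [InnerProductSpace 𝕜 F] {x y : E} {x' y' : F} {C : ℝ}
    (h : ∀ c : 𝕜, ‖x + c • y‖ ^ 2 = C * ‖x' + c • y'‖ ^ 2) :
    inner 𝕜 x y = (C : 𝕜) * inner 𝕜 x' y' := by
  have h' (c : 𝕜) : (‖x + c • y‖ : 𝕜) ^ 2 = C * (‖x' + c • y'‖ : 𝕜) ^ 2 := mod_cast h c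
  have h_one := h' 1
  have h_neg_one := h' (-1)
  have h_I := h' RCLike.I
  have h_neg_I := h' (-RCLike.I)
  simp only [one_smul, neg_smul, ← sub_eq_add_neg] at h_one h_neg_one h_I h_neg_I
  rw [inner_eq_sum_norm_sq_div_four, inner_eq_sum_norm_sq_div_four, h_one, h_neg_one, h_I, h_neg_I]
  ring

theorem integral_mul_conj_eq_inner {f g : α → 𝕜} (hf : MemLp f 2 μ) (hg : MemLp g 2 μ) :
    ∫ x, f x * conj (g x) ∂μ = inner 𝕜 (hg.toLp g) (hf.toLp f) := by
  rw [L2.inner_def]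
  refine integral_congr_ae ?_
  filter_upwards [hf.coeFn_toLp, hg.coeFn_toLp] with x hfx hgx
  rw [hfx, hgx, RCLike.inner_apply]

theorem integral_mul_conj_eq_of_eLpNorm_sq_eq {f g : α → 𝕜} {f' g' : β → 𝕜} {C : ℝ≥0∞}
    (hf : MemLp f 2 μ) (hg : MemLp g 2 μ) (hf' : MemLp f' 2 ν) (hg' : MemLp g' 2 ν)
    (h : ∀ c : 𝕜, eLpNorm (g + c • f) 2 μ ^ 2 = C * eLpNorm (g' + c • f') 2 ν ^ 2) :
    ∫ x, f x * conj (g x) ∂μ = (C.toReal : 𝕜) * ∫ x, f' x * conj (g' x) ∂ν := by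
  rw [integral_mul_conj_eq_inner hf hg, integral_mul_conj_eq_inner hf' hg']
  refine inner_eq_mul_inner_of_norm_add_smul_sq fun c => ?_
  rw [← MemLp.toLp_const_smul, ← MemLp.toLp_add, ← MemLp.toLp_const_smul, ← MemLp.toLp_add,
    Lp.norm_toLp, Lp.norm_toLp, ← ENNReal.toReal_pow, h, ENNReal.toReal_mul, ENNReal.toReal_pow]

theorem tendsto_eLpNorm_of_tendsto_eLpNorm_sub [NormedAddCommGroup E] {p : ℝ≥0∞}
    [Fact (1 ≤ p)] {ι : Type*} {l : Filter ι} {u : ι → α → E} {f : α → E}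
    (hu : ∀ n, MemLp (u n) p μ) (hf : MemLp f p μ)
    (h : Tendsto (fun n => eLpNorm (u n - f) p μ) l (𝓝 0)) :
    Tendsto (fun n => eLpNorm (u n) p μ) l (𝓝 (eLpNorm f p μ)) := by
  simpa only [Lp.enorm_toLp] using ((Lp.tendsto_Lp_iff_tendsto_eLpNorm'' u hu f hf).2 h).enorm

theorem tendsto_eLpNorm_add_const_smul [NormedAddCommGroup E] [NormedSpace 𝕜 E] {p : ℝ≥0∞}
    [Fact (1 ≤ p)] {ι : Type*} {l : Filter ι} {u v : ι → α → E}
    (hu : ∀ n, AEStronglyMeasurable (u n) μ) (hv : ∀ n, AEStronglyMeasurable (v n) μ)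
    (hu_lim : Tendsto (fun n => eLpNorm (u n) p μ) l (𝓝 0))
    (hv_lim : Tendsto (fun n => eLpNorm (v n) p μ) l (𝓝 0)) (c : 𝕜) :
    Tendsto (fun n => eLpNorm (u n + c • v n) p μ) l (𝓝 0) := by
  have h_sum : Tendsto (fun n => eLpNorm (u n) p μ + ‖c‖ₑ * eLpNorm (v n) p μ) l (𝓝 0) := by
    simpa using hu_lim.add (ENNReal.Tendsto.const_mul hv_lim (.inr enorm_ne_top))
  refine tendsto_of_tendsto_of_tendsto_of_le_of_le tendsto_const_nhds h_sum (fun _ => zero_le)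
    fun n => ?_
  simpa only [eLpNorm_const_smul] using eLpNorm_add_le (hu n) ((hv n).const_smul c) Fact.out

end SquareIntegrable

section AbsoluteValue

variable {K : Type*} [Field K] [TopologicalSpace K] [IsTopologicalRing K] [LocallyCompactSpace K]

theorem absVal_of_ne_zero {a : K} (ha : a ≠ 0) :
    absVal a = distribHaarChar K (Units.mk0 a ha) :=
  dif_neg ha

@[simp] theorem absVal_zero : absVal (0 : K) = 0 := dif_pos rfl

@[simp] theorem absVal_one : absVal (1 : K) = 1 := by
  rw [absVal_of_ne_zero one_ne_zero, Units.mk0_one, map_one]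

theorem absVal_ne_zero {a : K} (ha : a ≠ 0) : absVal a ≠ 0 := by
  rw [absVal_of_ne_zero ha]; exact distribHaarChar_pos.ne'

theorem absVal_mul (a b : K) : absVal (a * b) = absVal a * absVal b := by
  rcases eq_or_ne a 0 with rfl | ha
  · simp
  rcases eq_or_ne b 0 with rfl | hb
  · simp
  rw [absVal_of_ne_zero ha, absVal_of_ne_zero hb, absVal_of_ne_zero (mul_ne_zero ha hb),
    Units.mk0_mul, map_mul]

theorem absVal_inv (a : K) : absVal a⁻¹ = (absVal a)⁻¹ := by
  rcases eq_or_ne a 0 with rfl | ha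
  · simp
  exact eq_inv_of_mul_eq_one_left (by rw [← absVal_mul, inv_mul_cancel₀ ha, absVal_one])

section Measure

variable [MeasurableSpace K] [BorelSpace K] {μ : Measure K} [μ.IsAddHaarMeasure] [μ.Regular]
  {a : K}

open scoped Pointwise in
theorem measure_smul_set (ha : a ≠ 0) (s : Set K) : μ (a • s) = absVal a * μ s := by
  rw [absVal_of_ne_zero ha]
  exact (distribHaarChar_mul μ (Units.mk0 a ha) s).symm

open scoped Pointwise in
theorem map_mul_left (ha : a ≠ 0) : μ.map (a * ·) = (absVal a)⁻¹ • μ := by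
  ext s hs
  have h_preimage : (a * ·) ⁻¹' s = a⁻¹ • s := Set.preimage_smul₀ ha s
  rw [Measure.map_apply (measurable_const_mul a) hs, h_preimage,
    measure_smul_set (inv_ne_zero ha), absVal_inv]
  rfl

theorem lintegral_comp_mul_left (ha : a ≠ 0) (f : K → ℝ≥0∞) :
    ∫⁻ x, f (a * x) ∂μ = (absVal a : ℝ≥0∞)⁻¹ * ∫⁻ x, f x ∂μ := by
  have h := lintegral_map_equiv (μ := μ) f (Homeomorph.mulLeft₀ a ha).toMeasurableEquiv
  rw [Homeomorph.toMeasurableEquiv_coe, Homeomorph.coe_mulLeft₀, map_mul_left ha,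
    lintegral_smul_measure, ENNReal.smul_def, ENNReal.coe_inv (absVal_ne_zero ha)] at h
  exact h.symm

theorem integral_comp_mul_left {E : Type*} [NormedAddCommGroup E] [NormedSpace ℝ E]
    (ha : a ≠ 0) (f : K → E) :
    ∫ x, f (a * x) ∂μ = (absVal a : ℝ)⁻¹ • ∫ x, f x ∂μ := by
  have h := integral_map_equiv (μ := μ) (Homeomorph.mulLeft₀ a ha).toMeasurableEquiv f
  rw [Homeomorph.toMeasurableEquiv_coe, Homeomorph.coe_mulLeft₀, map_mul_left ha,
    integral_smul_nnreal_measure] at h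
  exact h.symm

theorem lintegral_comp_sub_div (ha : a ≠ 0) (b : K) (f : K → ℝ≥0∞) :
    ∫⁻ x, f ((x - b) / a) ∂μ = absVal a * ∫⁻ x, f x ∂μ := by
  rw [lintegral_sub_right_eq_self (fun x => f (x / a)) b]
  simp only [div_eq_inv_mul, lintegral_comp_mul_left (inv_ne_zero ha), absVal_inv,
    ENNReal.coe_inv (absVal_ne_zero ha), inv_inv]

theorem integral_comp_sub_div {E : Type*} [NormedAddCommGroup E] [NormedSpace ℝ E]
    (ha : a ≠ 0) (b : K) (f : K → E) :
    ∫ x, f ((x - b) / a) ∂μ = (absVal a : ℝ) • ∫ x, f x ∂μ := by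
  rw [integral_sub_right_eq_self (fun x => f (x / a)) b]
  simp only [div_eq_inv_mul, integral_comp_mul_left (inv_ne_zero ha), absVal_inv,
    NNReal.coe_inv, inv_inv]

theorem quasiMeasurePreserving_sub_div (ha : a ≠ 0) (b : K) :
    Measure.QuasiMeasurePreserving (fun x => (x - b) / a) μ μ := by
  have h_scale : Measure.QuasiMeasurePreserving (a⁻¹ * ·) μ μ :=
    ⟨measurable_const_mul _, map_mul_left (μ := μ) (inv_ne_zero ha) ▸
      Measure.smul_absolutelyContinuous⟩
  simpa only [Function.comp_def, div_eq_inv_mul] using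
    h_scale.comp (measurePreserving_sub_right μ b).quasiMeasurePreserving

variable {E : Type*} [NormedAddCommGroup E] {f : K → E} {p : ℝ≥0∞}

theorem memLp_comp_mul_left (hf : MemLp f p μ) (ha : a ≠ 0) :
    MemLp (fun x => f (a * x)) p μ := by
  have h : MemLp f p (μ.map (a * ·)) :=
    map_mul_left (μ := μ) ha ▸ hf.smul_measure ENNReal.coe_ne_top
  exact h.comp_of_map (measurable_const_mul a).aemeasurable

theorem memLp_comp_sub_div (hf : MemLp f p μ) (ha : a ≠ 0) (b : K) :
    MemLp (fun x => f ((x - b) / a)) p μ := by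
  simpa only [Function.comp_def, div_eq_inv_mul] using
    (memLp_comp_mul_left hf (inv_ne_zero ha)).comp_measurePreserving
      (measurePreserving_sub_right μ b)

end Measure

end AbsoluteValue

section AbsoluteValue

variable {K : Type*} [Field K] [TopologicalSpace K] [IsTopologicalDivisionRing K]
  [LocallyCompactSpace K] [T2Space K] [SecondCountableTopology K]

/-- `|a|` is the ratio of the volumes of `aC` and `C` for any compact neighbourhood `C` of `0`. -/
theorem measurable_absVal [MeasurableSpace K] [BorelSpace K] :
    Measurable (absVal : K → ℝ≥0) := by
  let μ : Measure K := Measure.addHaar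
  obtain ⟨C, hC, hC_nhds⟩ := exists_compact_mem_nhds (0 : K)
  have hC_pos : μ C ≠ 0 := (μ.measure_pos_of_mem_nhds hC_nhds).ne'
  have hC_fin : μ C ≠ ∞ := hC.measure_lt_top.ne
  have h_ratio (a : K) (ha : a ≠ 0) :
      absVal a = ((∫⁻ x, C.indicator 1 (a⁻¹ * x) ∂μ) / μ C).toNNReal := by
    rw [lintegral_comp_mul_left (inv_ne_zero ha), lintegral_indicator_one hC.measurableSet,
      ENNReal.mul_div_cancel_right hC_pos hC_fin, absVal_inv,
      ENNReal.coe_inv (inv_ne_zero (absVal_ne_zero ha)) |>.symm, inv_inv, ENNReal.toNNReal_coe]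
  have h_meas : Measurable fun a : K =>
      ((∫⁻ x, C.indicator 1 (a⁻¹ * x) ∂μ) / μ C).toNNReal := by
    refine (Measurable.div_const (Measurable.lintegral_prod_right ?_) _).ennreal_toNNReal
    exact (measurable_one.indicator hC.measurableSet).comp
      (measurable_fst.inv.mul measurable_snd)
  convert h_meas.indicator (measurableSet_singleton (0 : K)).compl using 1
  ext a
  rcases eq_or_ne a 0 with rfl | ha
  · simp
  · rw [Set.indicator_of_mem ha, h_ratio a ha]

end AbsoluteValue

section Fourier

open Fourier (fourierIntegral)

theorem fourierIntegral_eq_integral_mul {K : Type*} [CommRing K] [MeasurableSpace K]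
    (χ : AddChar K Circle) (μ : Measure K) (u : K → ℂ) (ξ : K) :
    fourierIntegral χ μ u ξ = ∫ x, (χ (-(x * ξ)) : ℂ) * u x ∂μ := rfl

variable {K : Type*} [CommRing K] [TopologicalSpace K] [IsTopologicalRing K] [MeasurableSpace K]
  [BorelSpace K] {μ : Measure K} {χ : AddChar K Circle}

section VectorValued

variable {E : Type*} [NormedAddCommGroup E] [NormedSpace ℂ E]
  {u v : K → E}

theorem fourierIntegral_add (hχ : Continuous χ) (hu : Integrable u μ) (hv : Integrable v μ) :
    fourierIntegral χ μ (u + v) = fourierIntegral χ μ u + fourierIntegral χ μ v :=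
  VectorFourier.fourierIntegral_add hχ continuous_mul hu hv

theorem fourierIntegral_sub (hχ : Continuous χ) (hu : Integrable u μ) (hv : Integrable v μ) :
    fourierIntegral χ μ (u - v) = fourierIntegral χ μ u - fourierIntegral χ μ v := by
  have h_neg := Fourier.fourierIntegral_const_smul χ μ v (-1)
  rw [neg_one_smul, neg_one_smul] at h_neg
  rw [sub_eq_add_neg, fourierIntegral_add hχ hu hv.neg, h_neg, ← sub_eq_add_neg]

theorem continuous_fourierIntegral [SecondCountableTopology K] (hχ : Continuous χ)
    (hu : Integrable u μ) : Continuous (fourierIntegral χ μ u) :=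
  VectorFourier.fourierIntegral_continuous hχ continuous_mul hu

end VectorValued

theorem integral_fourierIntegral_mul_comm [SecondCountableTopology K]
    [SigmaFinite μ] (hχ : Continuous χ) {u v : K → ℂ}
    (hu : Integrable u μ) (hv : Integrable v μ) :
    ∫ ξ, fourierIntegral χ μ u ξ * v ξ ∂μ = ∫ x, u x * fourierIntegral χ μ v x ∂μ := by
  have h := VectorFourier.integral_fourierIntegral_smul_eq_flip (μ := μ) (ν := μ)
    (L := LinearMap.mul K K) hχ continuous_mul hu hv
  rwa [LinearMap.flip_mul] at h

theorem fourierIntegral_comp_mul_left {K : Type*} [Field K] [TopologicalSpace K]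
    [IsTopologicalRing K] [LocallyCompactSpace K] [MeasurableSpace K] [BorelSpace K] {μ : Measure K}
    [μ.IsAddHaarMeasure] [μ.Regular] {χ : AddChar K Circle} {E : Type*} [NormedAddCommGroup E]
    [NormedSpace ℂ E] {a : K} (ha : a ≠ 0) (u : K → E) (ξ : K) :
    fourierIntegral χ μ (fun x => u (a * x)) ξ
      = (absVal a : ℝ)⁻¹ • fourierIntegral χ μ u (a⁻¹ * ξ) := by
  rw [Fourier.fourierIntegral_def, Fourier.fourierIntegral_def, ← integral_comp_mul_left ha]
  refine integral_congr_ae (ae_of_all _ fun x => ?_)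
  have h_dual : a * x * (a⁻¹ * ξ) = x * ξ := by field_simp
  simp only [h_dual]

end Fourier

section Autocorrelation

/-- The autocorrelation `t ↦ ∫ u(t + x) conj(u(x)) dx`, whose Fourier transform is `|û|²`. -/
noncomputable def autocorrelation {G : Type*} [Add G] [MeasurableSpace G] (μ : Measure G)
    (u : G → ℂ) (t : G) : ℂ :=
  ∫ x, u (t + x) * conj (u x) ∂μ

section AddGroup

variable {G : Type*} [AddCommGroup G] [TopologicalSpace G] [IsTopologicalAddGroup G]
  [MeasurableSpace G] [BorelSpace G] {μ : Measure G} [μ.IsAddLeftInvariant] {u : G → ℂ}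

theorem autocorrelation_eq_inner (hu : MemLp u 2 μ) (t : G) :
    autocorrelation μ u t = inner ℂ (hu.toLp u) (DomAddAct.mk t +ᵥ hu.toLp u) := by
  rw [DomAddAct.mk_vadd_toLp, ← integral_mul_conj_eq_inner]
  rfl

theorem norm_autocorrelation_le (hu : MemLp u 2 μ) (t : G) :
    ‖autocorrelation μ u t‖ ≤ ‖hu.toLp u‖ ^ 2 := by
  rw [autocorrelation_eq_inner hu, sq]
  simpa only [DomAddAct.norm_vadd_Lp] using
    norm_inner_le_norm (𝕜 := ℂ) (hu.toLp u) (DomAddAct.mk t +ᵥ hu.toLp u)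

theorem enorm_autocorrelation_zero (hu : MemLp u 2 μ) :
    ‖autocorrelation μ u 0‖ₑ = eLpNorm u 2 μ ^ 2 := by
  have h_inner := autocorrelation_eq_inner hu 0
  rw [DomAddAct.mk_zero, zero_vadd] at h_inner
  rw [h_inner, inner_self_eq_norm_sq_to_K, enorm_pow, ← Lp.enorm_toLp hu]
  simp only [← ofReal_norm, RCLike.norm_ofReal, abs_norm]

theorem continuous_autocorrelation [SecondCountableTopology G] [LocallyCompactSpace G]
    [μ.Regular] (hu : MemLp u 2 μ) : Continuous (autocorrelation μ u) := by
  simp only [funext (autocorrelation_eq_inner hu)]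
  have : Fact ((2 : ℝ≥0∞) ≠ ∞) := ⟨ENNReal.ofNat_ne_top⟩
  exact continuous_const.inner (DomAddAct.continuous_mk.vadd continuous_const)

theorem integrable_prod_autocorrelation [SecondCountableTopology G] [SFinite μ]
    (hu : Integrable u μ) :
    Integrable (fun p : G × G => u (p.1 + p.2) * conj (u p.2)) (μ.prod μ) := by
  have h_conj : Integrable (fun x => conj (u x)) μ :=
    memLp_one_iff_integrable.1 (memLp_one_iff_integrable.2 hu).star
  exact (measurePreserving_add_prod μ μ).integrable_comp_of_integrable (hu.mul_prod h_conj)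

theorem integrable_autocorrelation [SecondCountableTopology G] [SFinite μ]
    (hu : Integrable u μ) : Integrable (autocorrelation μ u) μ :=
  (integrable_prod_autocorrelation hu).integral_prod_left

end AddGroup

open Fourier (fourierIntegral) in
theorem fourierIntegral_autocorrelation {K : Type*} [CommRing K] [TopologicalSpace K]
    [IsTopologicalRing K] [SecondCountableTopology K] [MeasurableSpace K] [BorelSpace K]
    {μ : Measure K} [SFinite μ] [μ.IsAddLeftInvariant] {χ : AddChar K Circle}
    (hχ : Continuous χ) {u : K → ℂ} (hu : Integrable u μ) (ξ : K) :
    fourierIntegral χ μ (autocorrelation μ u) ξ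
      = fourierIntegral χ μ u ξ * conj (fourierIntegral χ μ u ξ) := by
  have h_int : Integrable
      (fun p : K × K => (χ (-(p.1 * ξ)) : ℂ) * (u (p.1 + p.2) * conj (u p.2))) (μ.prod μ) := by
    refine (integrable_prod_autocorrelation hu).bdd_mul (c := 1)
      (Continuous.aestronglyMeasurable (by fun_prop)) (ae_of_all _ fun p => (Circle.norm_coe _).le)
  have h_translate (x : K) :
      ∫ t, (χ (-(t * ξ)) : ℂ) * (u (t + x) * conj (u x)) ∂μ
        = fourierIntegral χ μ u ξ * ((χ (x * ξ) : ℂ) * conj (u x)) := by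
    have h_char (t : K) : χ (-((t - x) * ξ)) = χ (-(t * ξ)) * χ (x * ξ) := by
      rw [← AddChar.map_add_eq_mul]
      ring_nf
    rw [← integral_sub_right_eq_self _ x, fourierIntegral_eq_integral_mul, ← integral_mul_const]
    simp only [h_char, sub_add_cancel, Circle.coe_mul]
    exact integral_congr_ae (ae_of_all _ fun t => by ring)
  have h_conj : ∫ x, (χ (x * ξ) : ℂ) * conj (u x) ∂μ = conj (fourierIntegral χ μ u ξ) := by
    rw [fourierIntegral_eq_integral_mul, ← integral_conj]
    simp only [map_mul, AddChar.map_neg_eq_inv, Circle.coe_inv_eq_conj, Complex.conj_conj]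
  calc fourierIntegral χ μ (autocorrelation μ u) ξ
      = ∫ t, ∫ x, (χ (-(t * ξ)) : ℂ) * (u (t + x) * conj (u x)) ∂μ ∂μ := by
        simp only [fourierIntegral_eq_integral_mul, autocorrelation, integral_const_mul]
    _ = ∫ x, ∫ t, (χ (-(t * ξ)) : ℂ) * (u (t + x) * conj (u x)) ∂μ ∂μ :=
        integral_integral_swap h_int
    _ = fourierIntegral χ μ u ξ * conj (fourierIntegral χ μ u ξ) := by
        simp only [h_translate, integral_const_mul, h_conj]

end Autocorrelation

section Plancherel

open Fourier (fourierIntegral)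

/-- Plancherel's theorem on `L¹ ∩ L²`: the Fourier integral preserves the `L²` norm, which says
that `μ` is self-dual with respect to `χ`. -/
def IsPlancherel {K : Type*} [CommRing K] [MeasurableSpace K] (χ : AddChar K Circle)
    (μ : Measure K) : Prop :=
  ∀ ⦃u : K → ℂ⦄, Integrable u μ → MemLp u 2 μ → eLpNorm (fourierIntegral χ μ u) 2 μ = eLpNorm u 2 μ

section CommRing

variable {K : Type*} [CommRing K] [MeasurableSpace K]

theorem measureReal_eq_one_of_fourierIntegral_indicator {μ : Measure K} {χ : AddChar K Circle}
    {D : Set K} (hD : MeasurableSet D) (hD0 : 0 ∈ D)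
    (hD_dual : fourierIntegral χ μ (D.indicator 1 : K → ℂ) = D.indicator 1) : μ.real D = 1 := by
  have h := congrFun hD_dual 0
  rw [fourierIntegral_eq_integral_mul, Set.indicator_of_mem hD0] at h
  simp only [mul_zero, neg_zero, AddChar.map_zero_eq_one, Circle.coe_one, one_mul, Pi.one_apply,
    integral_indicator hD, integral_const, measureReal_restrict_apply_univ] at h
  simpa using h

variable [TopologicalSpace K] [IsTopologicalRing K] [BorelSpace K]

theorem aeCover_preimage_mul_left {μ : Measure K} {D : Set K} (hD : IsOpen D) (hD0 : 0 ∈ D) :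
    AECover μ (𝓝[≠] 0) fun a : K => (a * ·) ⁻¹' D where
  ae_eventually_mem := ae_of_all _ fun ξ => by
    have h : Tendsto (· * ξ) (𝓝 0) (𝓝 (0 * ξ)) := (continuous_mul_const ξ).tendsto 0
    rw [zero_mul] at h
    exact (h.mono_left nhdsWithin_le_nhds).eventually_mem (hD.mem_nhds hD0)
  measurableSet a := (hD.preimage (continuous_const_mul a)).measurableSet

variable [SecondCountableTopology K]

theorem continuous_setIntegral_comp_mul_left {E : Type*} [NormedAddCommGroup E] [NormedSpace ℝ E]
    {μ : Measure K} {D : Set K} (hD : μ D ≠ ∞) {v : K → E} (hv : Continuous v) {C : ℝ}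
    (hvC : ∀ t, ‖v t‖ ≤ C) : Continuous fun a => ∫ t in D, v (a * t) ∂μ :=
  continuous_of_dominated (bound := fun _ => C)
    (fun a => (hv.comp (continuous_const_mul a)).aestronglyMeasurable)
    (fun _ => ae_of_all _ fun _ => hvC _) (integrableOn_const hD)
    (ae_of_all _ fun t => hv.comp (continuous_mul_const t))

end CommRing

variable {K : Type*} [Field K] [TopologicalSpace K] [IsTopologicalRing K]
  [SecondCountableTopology K] [LocallyCompactSpace K] [MeasurableSpace K] [BorelSpace K]
  {μ : Measure K} [μ.IsAddHaarMeasure] {χ : AddChar K Circle} {D : Set K}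

theorem setIntegral_fourierIntegral_preimage_mul_left (hχ : Continuous χ) (hD : IsOpen D)
    (hD_fin : μ D ≠ ∞)
    (hD_dual : fourierIntegral χ μ (D.indicator 1 : K → ℂ) = D.indicator 1) {v : K → ℂ}
    (hv : Integrable v μ) {a : K} (ha : a ≠ 0) :
    ∫ ξ in (a * ·) ⁻¹' D, fourierIntegral χ μ v ξ ∂μ = ∫ t in D, v (a * t) ∂μ := by
  have h_int : Integrable (D.indicator 1 : K → ℂ) μ :=
    (integrable_indicator_iff hD.measurableSet).2 (integrableOn_const hD_fin)
  have h_int_comp : Integrable (fun t => v (a * t)) μ :=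
    memLp_one_iff_integrable.1 (memLp_comp_mul_left (memLp_one_iff_integrable.2 hv) ha)
  have h_mul_indicator {w : K → ℂ} {S : Set K} (hS : IsOpen S) :
      ∫ x in S, w x ∂μ = ∫ x, w x * S.indicator 1 x ∂μ := by
    simp only [← Set.indicator_mul_right, Pi.one_apply, mul_one,
      integral_indicator hS.measurableSet]
  calc ∫ ξ in (a * ·) ⁻¹' D, fourierIntegral χ μ v ξ ∂μ
      = ∫ ξ, fourierIntegral χ μ v (a⁻¹ * (a * ξ)) * D.indicator 1 (a * ξ) ∂μ := by
        rw [h_mul_indicator (hD.preimage (continuous_const_mul a))]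
        simp only [inv_mul_cancel_left₀ ha]
        rfl
    _ = (absVal a : ℝ)⁻¹ • ∫ t, fourierIntegral χ μ v (a⁻¹ * t) * D.indicator 1 t ∂μ :=
        integral_comp_mul_left ha fun t => fourierIntegral χ μ v (a⁻¹ * t) * D.indicator 1 t
    _ = ∫ t, fourierIntegral χ μ (fun t => v (a * t)) t * D.indicator 1 t ∂μ := by
        simp only [← integral_smul, fourierIntegral_comp_mul_left ha, smul_mul_assoc]
    _ = ∫ t, v (a * t) * D.indicator 1 t ∂μ := by
        rw [integral_fourierIntegral_mul_comm hχ h_int_comp h_int, hD_dual]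
    _ = ∫ t in D, v (a * t) ∂μ := (h_mul_indicator hD).symm

/-- Fourier inversion at `0`, tested against the dilates of the self-dual function `1_D`. -/
theorem lintegral_enorm_fourierIntegral_eq_of_nonneg [(𝓝[≠] (0 : K)).NeBot] (hχ : Continuous χ)
    (hD : IsOpen D) (hD0 : 0 ∈ D)
    (hD_dual : fourierIntegral χ μ (D.indicator 1 : K → ℂ) = D.indicator 1) {v : K → ℂ}
    (hv : Integrable v μ) (hv_cont : Continuous v) {C : ℝ} (hvC : ∀ t, ‖v t‖ ≤ C)
    (hv_nonneg : ∀ ξ, fourierIntegral χ μ v ξ = ‖fourierIntegral χ μ v ξ‖) :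
    ∫⁻ ξ, ‖fourierIntegral χ μ v ξ‖ₑ ∂μ = ‖v 0‖ₑ := by
  have h_vol : μ.real D = 1 :=
    measureReal_eq_one_of_fourierIntegral_indicator hD.measurableSet hD0 hD_dual
  have hD_fin : μ D ≠ ∞ := fun h => by simp [Measure.real, h] at h_vol
  have h_cont : Continuous (fourierIntegral χ μ v) := continuous_fourierIntegral hχ hv
  refine (aeCover_preimage_mul_left hD hD0).lintegral_eq_of_tendsto _ h_cont.enorm.aemeasurable ?_
  have h_piece {a : K} (ha : a ≠ 0) :
      ∫⁻ ξ in (a * ·) ⁻¹' D, ‖fourierIntegral χ μ v ξ‖ₑ ∂μ = ‖∫ t in D, v (a * t) ∂μ‖ₑ := by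
    have h_int : IntegrableOn (fourierIntegral χ μ v) ((a * ·) ⁻¹' D) μ := by
      refine Measure.integrableOn_of_bounded ?_ h_cont.aestronglyMeasurable
        (ae_of_all _ (Fourier.norm_fourierIntegral_le_integral_norm χ μ v))
      rw [← Measure.map_apply (measurable_const_mul a) hD.measurableSet, map_mul_left ha,
        Measure.smul_apply]
      exact ENNReal.mul_ne_top ENNReal.coe_ne_top hD_fin
    rw [← setIntegral_fourierIntegral_preimage_mul_left hχ hD hD_fin hD_dual hv ha,
      integral_congr_ae (ae_of_all _ hv_nonneg), integral_complex_ofReal,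
      ← ofReal_integral_norm_eq_lintegral_enorm h_int, ← ofReal_norm, Complex.norm_real,
      Real.norm_of_nonneg (integral_nonneg fun _ => norm_nonneg _)]
  have h_lim : Tendsto (fun a => ‖∫ t in D, v (a * t) ∂μ‖ₑ) (𝓝[≠] 0) (𝓝 ‖v 0‖ₑ) := by
    have h := (continuous_setIntegral_comp_mul_left hD_fin hv_cont hvC).enorm.tendsto 0
    simp only [zero_mul, setIntegral_const, h_vol, one_smul] at h
    exact h.mono_left nhdsWithin_le_nhds
  exact h_lim.congr' (eventually_mem_nhdsWithin.mono fun a ha => (h_piece ha).symm)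

theorem isPlancherel_of_fourierIntegral_indicator [(𝓝[≠] (0 : K)).NeBot] (hχ : Continuous χ)
    (hD : IsOpen D) (hD0 : 0 ∈ D)
    (hD_dual : fourierIntegral χ μ (D.indicator 1 : K → ℂ) = D.indicator 1) :
    IsPlancherel χ μ := by
  intro u hu hu2
  have h_sq (ξ : K) : fourierIntegral χ μ (autocorrelation μ u) ξ
      = ((‖fourierIntegral χ μ u ξ‖ ^ 2 : ℝ) : ℂ) := by
    rw [fourierIntegral_autocorrelation hχ hu, Complex.mul_conj, Complex.normSq_eq_norm_sq]
  have h := lintegral_enorm_fourierIntegral_eq_of_nonneg hχ hD hD0 hD_dual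
    (integrable_autocorrelation hu) (continuous_autocorrelation hu2) (norm_autocorrelation_le hu2)
    fun ξ => by simp [h_sq]
  rw [enorm_autocorrelation_zero hu2] at h
  refine (ENNReal.pow_right_strictMono two_ne_zero).injective ?_
  simp only [← h, eLpNorm_two_sq, h_sq, Complex.ofReal_pow, enorm_pow]
  simp only [← ofReal_norm, Complex.norm_real, norm_norm]

end Plancherel

section FourierL2

open Fourier (fourierIntegral)

theorem exists_seq_integrable_tendsto_eLpNorm_sub {α E : Type*} [MeasurableSpace α]
    [NormedAddCommGroup E] {μ : Measure α} {p : ℝ≥0∞} {f : α → E} (hf : MemLp f p μ)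
    (hp0 : p ≠ 0) (hp : p ≠ ∞) :
    ∃ u : ℕ → α → E, (∀ n, Integrable (u n) μ ∧ MemLp (u n) p μ) ∧
      Tendsto (fun n => eLpNorm (u n - f) p μ) atTop (𝓝 0) := by
  obtain ⟨ε, -, hε_pos, hε_lim⟩ := exists_seq_strictAnti_tendsto' (α := ℝ≥0∞) one_pos
  choose u hu_sub hu_memLp using fun n =>
    hf.exists_simpleFunc_eLpNorm_sub_lt hp (hε_pos n).1.ne'
  refine ⟨fun n => u n, fun n => ⟨?_, hu_memLp n⟩, ?_⟩
  · exact (SimpleFunc.memLp_iff_integrable hp0 hp).1 (hu_memLp n)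
  · refine tendsto_of_tendsto_of_tendsto_of_le_of_le tendsto_const_nhds hε_lim
      (fun _ => zero_le) fun n => ?_
    exact (eLpNorm_sub_comm _ _ _ _).trans_le (hu_sub n).le

theorem IsFourierL2.congr_right {K : Type*} [Field K] [MeasurableSpace K] {μ : Measure K}
    {χ : AddChar K Circle} {f g g' : K → ℂ} (h : IsFourierL2 χ μ f g) (hg : g =ᵐ[μ] g') :
    IsFourierL2 χ μ f g' := by
  obtain ⟨hg_memLp, u, hu, hu_lim, hFu_lim⟩ := h
  refine ⟨(memLp_congr_ae hg).1 hg_memLp, u, hu, hu_lim, ?_⟩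
  simpa only [eLpNorm_congr_ae (EventuallyEq.rfl.sub hg)] using hFu_lim

variable {K : Type*} [Field K] [TopologicalSpace K] [IsTopologicalRing K]
  [SecondCountableTopology K] [MeasurableSpace K] [BorelSpace K] {μ : Measure K}
  {χ : AddChar K Circle}

theorem IsFourierL2.add_const_smul (hχ : Continuous χ) {f g f' g' : K → ℂ}
    (hf : MemLp f 2 μ) (hf' : MemLp f' 2 μ) (h : IsFourierL2 χ μ f g)
    (h' : IsFourierL2 χ μ f' g') (c : ℂ) : IsFourierL2 χ μ (f + c • f') (g + c • g') := by
  obtain ⟨hg, u, hu, hu_lim, hFu_lim⟩ := h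
  obtain ⟨hg', v, hv, hv_lim, hFv_lim⟩ := h'
  have h_meas {w : K → ℂ} (hw : Integrable w μ) :
      AEStronglyMeasurable (fourierIntegral χ μ w) μ :=
    (continuous_fourierIntegral hχ hw).aestronglyMeasurable
  have h_sub (w w' v v' : K → ℂ) : w + c • w' - (v + c • v') = w - v + c • (w' - v') := by
    rw [smul_sub, add_sub_add_comm]
  refine ⟨hg.add (hg'.const_smul c), fun n => u n + c • v n,
    fun n => ⟨(hu n).1.add ((hv n).1.smul c), (hu n).2.add ((hv n).2.const_smul c)⟩, ?_, ?_⟩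
  · simp only [h_sub]
    exact tendsto_eLpNorm_add_const_smul (fun n => ((hu n).2.sub hf).1)
      (fun n => ((hv n).2.sub hf').1) hu_lim hv_lim c
  · simp only [fourierIntegral_add hχ (hu _).1 ((hv _).1.smul c),
      Fourier.fourierIntegral_const_smul, h_sub]
    exact tendsto_eLpNorm_add_const_smul (fun n => (h_meas (hu n).1).sub hg.1)
      (fun n => (h_meas (hv n).1).sub hg'.1) hFu_lim hFv_lim c

theorem IsPlancherel.memLp_fourierIntegral (hP : IsPlancherel χ μ) (hχ : Continuous χ)
    {u : K → ℂ} (hu : Integrable u μ) (hu2 : MemLp u 2 μ) : MemLp (fourierIntegral χ μ u) 2 μ :=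
  ⟨(continuous_fourierIntegral hχ hu).aestronglyMeasurable, (hP hu hu2).trans_lt hu2.2⟩

theorem IsPlancherel.exists_isFourierL2 (hP : IsPlancherel χ μ) (hχ : Continuous χ) {f : K → ℂ}
    (hf : MemLp f 2 μ) : ∃ g, IsFourierL2 χ μ f g := by
  obtain ⟨u, hu, hu_lim⟩ :=
    exists_seq_integrable_tendsto_eLpNorm_sub hf two_ne_zero ENNReal.ofNat_ne_top
  have hFu (n : ℕ) : MemLp (fourierIntegral χ μ (u n)) 2 μ :=
    hP.memLp_fourierIntegral hχ (hu n).1 (hu n).2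
  have h_edist (m n : ℕ) : edist ((hFu m).toLp _) ((hFu n).toLp _)
      = edist ((hu m).2.toLp (u m)) ((hu n).2.toLp (u n)) := by
    rw [Lp.edist_toLp_toLp, Lp.edist_toLp_toLp, ← fourierIntegral_sub hχ (hu m).1 (hu n).1,
      hP ((hu m).1.sub (hu n).1) ((hu m).2.sub (hu n).2)]
  have hu_cauchy : CauchySeq fun n => (hu n).2.toLp (u n) :=
    ((Lp.tendsto_Lp_iff_tendsto_eLpNorm'' u (fun n => (hu n).2) f hf).2 hu_lim).cauchySeq
  have hFu_cauchy : CauchySeq fun n => (hFu n).toLp (fourierIntegral χ μ (u n)) := by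
    simpa only [EMetric.cauchySeq_iff, h_edist] using hu_cauchy
  obtain ⟨g, hg⟩ := cauchySeq_tendsto_of_complete hFu_cauchy
  refine ⟨g, Lp.memLp g, u, hu, hu_lim, ?_⟩
  rwa [← Lp.tendsto_Lp_iff_tendsto_eLpNorm'' _ hFu _ (Lp.memLp g), Lp.toLp_coeFn]

theorem IsPlancherel.isFourierL2_fourierL2 (hP : IsPlancherel χ μ) (hχ : Continuous χ)
    {f : K → ℂ} (hf : MemLp f 2 μ) : IsFourierL2 χ μ f (fourierL2 χ μ f) := by
  have h := hP.exists_isFourierL2 hχ hf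
  rw [fourierL2, dif_pos h]
  exact h.choose_spec

theorem IsPlancherel.eLpNorm_eq (hP : IsPlancherel χ μ) (hχ : Continuous χ) {f g : K → ℂ}
    (hf : MemLp f 2 μ) (h : IsFourierL2 χ μ f g) : eLpNorm g 2 μ = eLpNorm f 2 μ := by
  obtain ⟨hg, u, hu, hu_lim, hFu_lim⟩ := h
  have h_lim := tendsto_eLpNorm_of_tendsto_eLpNorm_sub
    (fun n => hP.memLp_fourierIntegral hχ (hu n).1 (hu n).2) hg hFu_lim
  simp only [hP (hu _).1 (hu _).2] at h_lim
  exact tendsto_nhds_unique h_lim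
    (tendsto_eLpNorm_of_tendsto_eLpNorm_sub (fun n => (hu n).2) hf hu_lim)

theorem IsPlancherel.integral_mul_conj (hP : IsPlancherel χ μ) (hχ : Continuous χ)
    {f g f' g' : K → ℂ} (hf : MemLp f 2 μ) (hf' : MemLp f' 2 μ) (h : IsFourierL2 χ μ f g)
    (h' : IsFourierL2 χ μ f' g') : ∫ x, f x * conj (f' x) ∂μ = ∫ ξ, g ξ * conj (g' ξ) ∂μ := by
  have h_norm (c : ℂ) : eLpNorm (f' + c • f) 2 μ ^ 2 = 1 * eLpNorm (g' + c • g) 2 μ ^ 2 := by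
    rw [one_mul, hP.eLpNorm_eq hχ (hf'.add (hf.const_smul c))
      (h'.add_const_smul hχ hf' hf h c)]
  simpa using integral_mul_conj_eq_of_eLpNorm_sq_eq hf hf' h.1 h'.1 h_norm

end FourierL2

section Daughter

open Fourier (fourierIntegral)

/-- The Fourier transform of a daughter wavelet `ψ_{a,b}`, in terms of the Fourier transform `g`
of `ψ`. -/
noncomputable def daughterFourier {K : Type*} [Field K] [TopologicalSpace K] [IsTopologicalRing K]
    [LocallyCompactSpace K] (χ : AddChar K Circle) (g : K → ℂ) (a b ξ : K) : ℂ :=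
  (Real.sqrt (absVal a) : ℂ) * (χ (-(b * ξ)) * g (a * ξ))

variable {K : Type*} [Field K] [TopologicalSpace K] [IsTopologicalRing K] [LocallyCompactSpace K]

theorem daughter_zero_left (u : K → ℂ) (b : K) : daughter u 0 b = 0 := by
  ext x
  simp [daughter]

theorem daughter_sub (u v : K → ℂ) (a b : K) :
    daughter (u - v) a b = daughter u a b - daughter v a b := by
  ext x
  simp only [daughter, Pi.sub_apply, mul_sub]

theorem daughterFourier_sub (χ : AddChar K Circle) (g g' : K → ℂ) (a b : K) :
    daughterFourier χ (g - g') a b = daughterFourier χ g a b - daughterFourier χ g' a b := by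
  ext ξ
  simp only [daughterFourier, Pi.sub_apply, mul_sub]

theorem daughterFourier_eq_char_mul_daughter (χ : AddChar K Circle) (g : K → ℂ) (a b ξ : K) :
    daughterFourier χ g a b ξ = χ (-(b * ξ)) * daughter g a⁻¹ 0 ξ := by
  rw [daughterFourier, daughter, absVal_inv, NNReal.coe_inv, Real.sqrt_inv, one_div, inv_inv,
    sub_zero, div_inv_eq_mul, mul_comm ξ a, mul_left_comm]

theorem enorm_daughter_sq (u : K → ℂ) {a : K} (ha : a ≠ 0) (b x : K) :
    ‖daughter u a b x‖ₑ ^ 2 = (absVal a : ℝ≥0∞)⁻¹ * ‖u ((x - b) / a)‖ₑ ^ 2 := by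
  have h_factor : ‖((1 / Real.sqrt (absVal a) : ℝ) : ℂ)‖ₑ ^ 2 = (absVal a : ℝ≥0∞)⁻¹ := by
    rw [← ofReal_norm, Complex.norm_real, ← ENNReal.ofReal_pow (norm_nonneg _),
      Real.norm_eq_abs, sq_abs, div_pow, one_pow, Real.sq_sqrt (absVal a).coe_nonneg, one_div,
      ← NNReal.coe_inv, ENNReal.ofReal_coe_nnreal, ENNReal.coe_inv (absVal_ne_zero ha)]
  rw [daughter, enorm_mul, mul_pow, h_factor]

variable [SecondCountableTopology K] [MeasurableSpace K] [BorelSpace K] {μ : Measure K}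
  [μ.IsAddHaarMeasure] {χ : AddChar K Circle}

theorem eLpNorm_daughter (u : K → ℂ) {a : K} (ha : a ≠ 0) (b : K) :
    eLpNorm (daughter u a b) 2 μ = eLpNorm u 2 μ := by
  have h_ne_zero : (absVal a : ℝ≥0∞) ≠ 0 := ENNReal.coe_ne_zero.2 (absVal_ne_zero ha)
  refine (ENNReal.pow_right_strictMono two_ne_zero).injective ?_
  simp only [eLpNorm_two_sq, enorm_daughter_sq u ha]
  rw [lintegral_const_mul' _ _ (ENNReal.inv_ne_top.2 h_ne_zero),
    lintegral_comp_sub_div ha b fun x => ‖u x‖ₑ ^ 2, ← mul_assoc,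
    ENNReal.inv_mul_cancel h_ne_zero ENNReal.coe_ne_top, one_mul]

theorem memLp_daughter {u : K → ℂ} {p : ℝ≥0∞} (hu : MemLp u p μ) (a b : K) :
    MemLp (daughter u a b) p μ := by
  rcases eq_or_ne a 0 with rfl | ha
  · exact daughter_zero_left u b ▸ MemLp.zero
  · exact (memLp_comp_sub_div hu ha b).const_mul _

theorem daughter_ae_congr {u v : K → ℂ} (h : u =ᵐ[μ] v) (a b : K) :
    daughter u a b =ᵐ[μ] daughter v a b := by
  rcases eq_or_ne a 0 with rfl | ha
  · rw [daughter_zero_left, daughter_zero_left]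
  · filter_upwards [(quasiMeasurePreserving_sub_div ha b).ae_eq_comp h] with x hx
    exact congrArg _ hx

theorem eLpNorm_daughterFourier (g : K → ℂ) {a : K} (ha : a ≠ 0) (b : K) :
    eLpNorm (daughterFourier χ g a b) 2 μ = eLpNorm g 2 μ := by
  rw [← eLpNorm_daughter g (inv_ne_zero ha) 0]
  refine eLpNorm_congr_norm_ae (ae_of_all _ fun ξ => ?_)
  rw [daughterFourier_eq_char_mul_daughter, norm_mul, Circle.norm_coe, one_mul]

theorem memLp_daughterFourier (hχ : Continuous χ) {g : K → ℂ} (hg : MemLp g 2 μ) {a : K}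
    (ha : a ≠ 0) (b : K) : MemLp (daughterFourier χ g a b) 2 μ := by
  have h_char : Continuous fun ξ => (χ (-(b * ξ)) : ℂ) := by fun_prop
  refine ⟨?_, (eLpNorm_daughterFourier g ha b).trans_lt hg.2⟩
  simp only [funext (daughterFourier_eq_char_mul_daughter χ g a b)]
  exact h_char.aestronglyMeasurable.mul (memLp_daughter hg a⁻¹ 0).1

theorem fourierIntegral_daughter (u : K → ℂ) {a : K} (ha : a ≠ 0) (b : K) :
    fourierIntegral χ μ (daughter u a b) = daughterFourier χ (fourierIntegral χ μ u) a b := by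
  ext ξ
  have h_integrand (x : K) : (χ (-(x * ξ)) : ℂ) * daughter u a b x
      = ((1 / Real.sqrt (absVal a) : ℝ) * χ (-(b * ξ)) : ℂ)
        * (χ (-((x - b) / a * (a * ξ))) * u ((x - b) / a)) := by
    have h_char : -(x * ξ) = -(b * ξ) + -((x - b) / a * (a * ξ)) := by field_simp; ring
    rw [h_char, AddChar.map_add_eq_mul, Circle.coe_mul, daughter]
    ring
  have h_sqrt : ((1 / Real.sqrt (absVal a) : ℝ) : ℂ) * (absVal a : ℝ) = Real.sqrt (absVal a) := by
    rw [← Complex.ofReal_mul, one_div, inv_mul_eq_div, Real.div_sqrt]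
  simp only [fourierIntegral_eq_integral_mul, h_integrand, daughterFourier]
  rw [integral_const_mul, integral_comp_sub_div ha b fun y => (χ (-(y * (a * ξ))) : ℂ) * u y,
    Complex.real_smul, ← h_sqrt]
  ring

theorem IsFourierL2.daughter (hχ : Continuous χ) {ψ g : K → ℂ} (h : IsFourierL2 χ μ ψ g)
    {a : K} (ha : a ≠ 0) (b : K) :
    IsFourierL2 χ μ (daughter ψ a b) (daughterFourier χ g a b) := by
  obtain ⟨hg, u, hu, hu_lim, hFu_lim⟩ := h
  refine ⟨memLp_daughterFourier hχ hg ha b, fun n => LocalFieldWavelet.daughter (u n) a b,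
    fun n => ⟨memLp_one_iff_integrable.1
      (memLp_daughter (memLp_one_iff_integrable.2 (hu n).1) a b), memLp_daughter (hu n).2 a b⟩,
    ?_, ?_⟩
  · simpa only [← daughter_sub, eLpNorm_daughter _ ha b] using hu_lim
  · simpa only [fourierIntegral_daughter _ ha b, ← daughterFourier_sub,
      eLpNorm_daughterFourier _ ha b] using hFu_lim

end Daughter

section WaveletTransform

open Fourier (fourierIntegral)

variable {K : Type*} [Field K] [TopologicalSpace K] [LocallyCompactSpace K] [MeasurableSpace K]

section TopologicalRing

variable [IsTopologicalRing K] {μ : Measure K} {ψ f : K → ℂ}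

theorem integral_cwt_mul_daughter_mul_conj (ψ f h : K → ℂ) (a b : K) :
    ∫ x, (cwt μ ψ f a b * daughter ψ a b x) * conj (h x) ∂μ
      = cwt μ ψ f a b * conj (cwt μ ψ h a b) := by
  have h_conj : conj (cwt μ ψ h a b) = ∫ x, daughter ψ a b x * conj (h x) ∂μ := by
    rw [cwt, ← integral_conj]
    simp only [map_mul, Complex.conj_conj, mul_comm]
  simp only [mul_assoc, integral_const_mul, h_conj]

variable [SecondCountableTopology K] [BorelSpace K] {χ : AddChar K Circle}

variable [μ.IsAddHaarMeasure]

theorem cwt_congr {ψ' f' : K → ℂ} (hψ : ψ =ᵐ[μ] ψ') (hf : f =ᵐ[μ] f') (a b : K) :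
    cwt μ ψ f a b = cwt μ ψ' f' a b := by
  refine integral_congr_ae ?_
  filter_upwards [hf, daughter_ae_congr hψ a b] with x hfx hψx
  rw [hfx, hψx]

theorem cwt_add_const_smul {f' : K → ℂ} (hψ : MemLp ψ 2 μ) (hf : MemLp f 2 μ)
    (hf' : MemLp f' 2 μ) (c : ℂ) (a b : K) :
    cwt μ ψ (f + c • f') a b = cwt μ ψ f a b + c * cwt μ ψ f' a b := by
  have hψ_ab := memLp_daughter hψ a b
  simp only [cwt, Pi.add_apply, Pi.smul_apply, smul_eq_mul, add_mul, mul_assoc]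
  rw [integral_add (integrable_mul_conj hf hψ_ab)
    ((integrable_mul_conj hf' hψ_ab).const_mul c), integral_const_mul]

theorem cwt_eq_fourierIntegral (hP : IsPlancherel χ μ) (hχ : Continuous χ) {g φ : K → ℂ}
    (hψ : MemLp ψ 2 μ) (hf : MemLp f 2 μ) (hg : IsFourierL2 χ μ ψ g)
    (hφ : IsFourierL2 χ μ f φ) {a : K} (ha : a ≠ 0) (b : K) :
    cwt μ ψ f a b
      = Real.sqrt (absVal a) * fourierIntegral χ μ (fun ξ => φ ξ * conj (g (a * ξ))) (-b) := by
  rw [cwt, hP.integral_mul_conj hχ hf (memLp_daughter hψ a b) hφ (hg.daughter hχ ha b),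
    fourierIntegral_eq_integral_mul, ← integral_const_mul]
  refine integral_congr_ae (ae_of_all _ fun ξ => ?_)
  simp only [daughterFourier, map_mul, Complex.conj_ofReal, AddChar.map_neg_eq_inv,
    Circle.coe_inv_eq_conj, Complex.conj_conj, mul_neg, neg_neg, mul_comm ξ b]
  ring

theorem lintegral_enorm_cwt_sq (hP : IsPlancherel χ μ) (hχ : Continuous χ) {g φ : K → ℂ}
    (hψ : MemLp ψ 2 μ) (hf : MemLp f 2 μ) (hg : IsFourierL2 χ μ ψ g)
    (hφ : IsFourierL2 χ μ f φ) {a : K} (ha : a ≠ 0)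
    (h_fin : ∫⁻ ξ, ‖φ ξ‖ₑ ^ 2 * ‖g (a * ξ)‖ₑ ^ 2 ∂μ ≠ ∞) :
    ∫⁻ b, ‖cwt μ ψ f a b‖ₑ ^ 2 ∂μ
      = absVal a * ∫⁻ ξ, ‖φ ξ‖ₑ ^ 2 * ‖g (a * ξ)‖ₑ ^ 2 ∂μ := by
  let w : K → ℂ := fun ξ => φ ξ * conj (g (a * ξ))
  have hw : Integrable w μ := integrable_mul_conj hφ.1 (memLp_comp_mul_left hg.1 ha)
  have hw_norm : eLpNorm w 2 μ ^ 2 = ∫⁻ ξ, ‖φ ξ‖ₑ ^ 2 * ‖g (a * ξ)‖ₑ ^ 2 ∂μ := by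
    simp only [eLpNorm_two_sq, w, enorm_mul, mul_pow, RCLike.enorm_conj]
  have hw2 : MemLp w 2 μ :=
    ⟨hw.1, lt_top_iff_ne_top.2 fun h => h_fin (by rw [← hw_norm, h, ENNReal.top_pow two_ne_zero])⟩
  have h_sqrt : ‖(Real.sqrt (absVal a) : ℂ)‖ₑ ^ 2 = absVal a := by
    rw [← ofReal_norm, Complex.norm_real, ← ENNReal.ofReal_pow (norm_nonneg _),
      Real.norm_eq_abs, sq_abs, Real.sq_sqrt (absVal a).coe_nonneg, ENNReal.ofReal_coe_nnreal]
  simp only [cwt_eq_fourierIntegral hP hχ hψ hf hg hφ ha, enorm_mul, mul_pow, h_sqrt]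
  rw [lintegral_const_mul' _ _ ENNReal.coe_ne_top,
    lintegral_neg_eq_self fun b => ‖fourierIntegral χ μ w b‖ₑ ^ 2, ← eLpNorm_two_sq, hP hw hw2,
    hw_norm]

end TopologicalRing

variable [SecondCountableTopology K] [BorelSpace K] [IsTopologicalDivisionRing K] [T2Space K]
  {μ : Measure K} {χ : AddChar K Circle} {ψ f : K → ℂ}

theorem IsPlancherel.ae_eq_zero_of_admissibilityConst_eq_zero (hP : IsPlancherel χ μ)
    (hχ : Continuous χ) (hψ : MemLp ψ 2 μ) (h : admissibilityConst χ μ ψ = 0) : ψ =ᵐ[μ] 0 := by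
  have hg := hP.isFourierL2_fourierL2 hχ hψ
  have h_zero : fourierL2 χ μ ψ =ᵐ[μ] 0 := by
    refine ((lintegral_eq_zero_iff' ?_).1 h).mono fun ξ hξ => ?_
    · exact (hg.1.1.enorm.pow_const 2).div measurable_absVal.coe_nnreal_ennreal.aemeasurable
    · simpa using hξ
  rw [← eLpNorm_eq_zero_iff hψ.1 two_ne_zero, ← hP.eLpNorm_eq hχ hψ hg, eLpNorm_congr_ae h_zero,
    eLpNorm_zero]

variable [μ.IsAddHaarMeasure]

theorem stronglyMeasurable_cwt (hψ : AEStronglyMeasurable ψ μ) (hf : AEStronglyMeasurable f μ) :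
    StronglyMeasurable fun p : K × K => cwt μ ψ f p.1 p.2 := by
  obtain ⟨ψ', hψ', hψ_eq⟩ := hψ
  obtain ⟨f', hf', hf_eq⟩ := hf
  simp only [cwt_congr hψ_eq hf_eq]
  refine StronglyMeasurable.integral_prod_right'
    (f := fun q : (K × K) × K => f' q.2 * conj (daughter ψ' q.1.1 q.1.2 q.2))
    (Measurable.stronglyMeasurable ?_)
  have h_abs : Measurable fun q : (K × K) × K => (absVal q.1.1 : ℝ) :=
    (measurable_absVal.comp (by fun_prop)).coe_nnreal_real
  have h_comp : Measurable fun q : (K × K) × K => ψ' ((q.2 - q.1.2) / q.1.1) :=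
    hψ'.measurable.comp (by fun_prop)
  have h_daughter : Measurable fun q : (K × K) × K => daughter ψ' q.1.1 q.1.2 q.2 :=
    (Complex.measurable_ofReal.comp (h_abs.sqrt.const_div 1)).mul h_comp
  exact (hf'.measurable.comp measurable_snd).mul
    (Complex.continuous_conj.measurable.comp h_daughter)

/-- `da / |a|` is a Haar measure of the multiplicative group. -/
theorem lintegral_comp_mul_right_div_absVal (G : K → ℝ≥0∞) {ξ : K} (hξ : ξ ≠ 0) :
    ∫⁻ a, G (a * ξ) / absVal a ∂μ = ∫⁻ η, G η / absVal η ∂μ := by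
  have h_ne_zero : (absVal ξ : ℝ≥0∞) ≠ 0 := ENNReal.coe_ne_zero.2 (absVal_ne_zero hξ)
  have h_integrand (a : K) : G (a * ξ) / absVal a
      = absVal ξ * (G (ξ * a) / absVal (ξ * a)) := by
    rw [absVal_mul, ENNReal.coe_mul, mul_comm a ξ, ← mul_div_assoc,
      ENNReal.mul_div_mul_left _ _ h_ne_zero ENNReal.coe_ne_top]
  simp only [h_integrand]
  rw [lintegral_const_mul' _ _ ENNReal.coe_ne_top,
    lintegral_comp_mul_left hξ fun η => G η / absVal η, ← mul_assoc,
    ENNReal.mul_inv_cancel h_ne_zero ENNReal.coe_ne_top, one_mul]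

variable [(𝓝[≠] (0 : K)).NeBot]

theorem lintegral_lintegral_mul_comp_mul_div_absVal {F G : K → ℝ≥0∞} (hF : Measurable F)
    (hG : Measurable G) :
    ∫⁻ a, (∫⁻ ξ, F ξ * G (a * ξ) ∂μ) / absVal a ∂μ
      = (∫⁻ η, G η / absVal η ∂μ) * ∫⁻ ξ, F ξ ∂μ := by
  have h_meas : Measurable fun p : K × K => F p.2 * G (p.1 * p.2) / absVal p.1 :=
    ((hF.comp measurable_snd).mul (hG.comp measurable_mul)).div
      (measurable_absVal.comp measurable_fst).coe_nnreal_ennreal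
  calc ∫⁻ a, (∫⁻ ξ, F ξ * G (a * ξ) ∂μ) / absVal a ∂μ
      = ∫⁻ a, ∫⁻ ξ, F ξ * G (a * ξ) / absVal a ∂μ ∂μ := by
        simp only [div_eq_mul_inv]
        exact lintegral_congr fun a =>
          (lintegral_mul_const _ (hF.mul (hG.comp (measurable_const_mul a)))).symm
    _ = ∫⁻ ξ, ∫⁻ a, F ξ * G (a * ξ) / absVal a ∂μ ∂μ :=
        lintegral_lintegral_swap h_meas.aemeasurable
    _ = ∫⁻ ξ, F ξ * ∫⁻ η, G η / absVal η ∂μ ∂μ := by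
        refine lintegral_congr_ae ((Measure.ae_ne μ 0).mono fun ξ hξ => ?_)
        beta_reduce
        rw [← lintegral_comp_mul_right_div_absVal G hξ, ← lintegral_const_mul]
        · simp only [mul_div_assoc]
        · exact (hG.comp (measurable_mul_const ξ)).div measurable_absVal.coe_nnreal_ennreal
    _ = (∫⁻ η, G η / absVal η ∂μ) * ∫⁻ ξ, F ξ ∂μ := by
        rw [lintegral_mul_const _ hF, mul_comm]

theorem lintegral_scaleMeasure {F : K × K → ℝ≥0∞} (hF : Measurable F) :
    ∫⁻ p, F p ∂(scaleMeasure μ) = ∫⁻ a, (∫⁻ b, F (a, b) ∂μ) / (absVal a : ℝ≥0∞) ^ 2 ∂μ := by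
  have h_weight : Measurable fun p : K × K => (((absVal p.1 ^ 2)⁻¹ : ℝ≥0) : ℝ≥0∞) :=
    ((measurable_absVal.comp measurable_fst).pow_const 2).inv.coe_nnreal_ennreal
  rw [scaleMeasure, lintegral_withDensity_eq_lintegral_mul _ h_weight hF,
    lintegral_prod _ (h_weight.mul hF).aemeasurable]
  refine lintegral_congr_ae ((Measure.ae_ne μ 0).mono fun a ha => ?_)
  simp only [Pi.mul_apply, lintegral_const_mul' _ _ ENNReal.coe_ne_top]
  rw [ENNReal.coe_inv (pow_ne_zero 2 (absVal_ne_zero ha)), ENNReal.coe_pow, mul_comm,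
    div_eq_mul_inv]

theorem eLpNorm_cwt_sq_of_isFourierL2 (hP : IsPlancherel χ μ) (hχ : Continuous χ) {g φ : K → ℂ}
    (hψ : MemLp ψ 2 μ) (hf : MemLp f 2 μ) (hg : IsFourierL2 χ μ ψ g)
    (hφ : IsFourierL2 χ μ f φ) (hg_meas : Measurable g) (hφ_meas : Measurable φ)
    (hg_fin : ∫⁻ η, ‖g η‖ₑ ^ 2 / absVal η ∂μ ≠ ∞) :
    eLpNorm (fun p : K × K => cwt μ ψ f p.1 p.2) 2 (scaleMeasure μ) ^ 2
      = (∫⁻ η, ‖g η‖ₑ ^ 2 / absVal η ∂μ) * eLpNorm f 2 μ ^ 2 := by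
  let S : K → ℝ≥0∞ := fun a => ∫⁻ ξ, ‖φ ξ‖ₑ ^ 2 * ‖g (a * ξ)‖ₑ ^ 2 ∂μ
  have h_total : ∫⁻ a, S a / absVal a ∂μ
      = (∫⁻ η, ‖g η‖ₑ ^ 2 / absVal η ∂μ) * eLpNorm f 2 μ ^ 2 := by
    rw [← hP.eLpNorm_eq hχ hf hφ, eLpNorm_two_sq]
    exact lintegral_lintegral_mul_comp_mul_div_absVal (hφ_meas.enorm.pow_const 2)
      (hg_meas.enorm.pow_const 2)
  have hS_meas : Measurable S := by
    refine Measurable.lintegral_prod_right'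
      (f := fun p : K × K => ‖φ p.2‖ₑ ^ 2 * ‖g (p.1 * p.2)‖ₑ ^ 2) ?_
    exact ((hφ_meas.comp measurable_snd).enorm.pow_const 2).mul
      ((hg_meas.comp measurable_mul).enorm.pow_const 2)
  have hS_fin : ∀ᵐ a ∂μ, S a / absVal a < ∞ := by
    refine ae_lt_top (hS_meas.div measurable_absVal.coe_nnreal_ennreal) ?_
    exact h_total ▸ ENNReal.mul_ne_top hg_fin (ENNReal.pow_ne_top hf.2.ne)
  rw [eLpNorm_two_sq, lintegral_scaleMeasure
    ((stronglyMeasurable_cwt hψ.1 hf.1).measurable.enorm.pow_const 2), ← h_total]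
  refine lintegral_congr_ae ?_
  filter_upwards [hS_fin, Measure.ae_ne μ 0] with a hSa ha
  have ha_ne_zero : (absVal a : ℝ≥0∞) ≠ 0 := ENNReal.coe_ne_zero.2 (absVal_ne_zero ha)
  have hSa_fin : S a ≠ ∞ := fun h => by
    rw [h, ENNReal.top_div_of_ne_top ENNReal.coe_ne_top] at hSa
    exact hSa.ne rfl
  rw [lintegral_enorm_cwt_sq hP hχ hψ hf hg hφ ha hSa_fin, sq,
    ENNReal.mul_div_mul_left _ _ ha_ne_zero ENNReal.coe_ne_top]

theorem IsAdmissible.eLpNorm_cwt_sq (hψ : IsAdmissible χ μ ψ) (hP : IsPlancherel χ μ)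
    (hχ : Continuous χ) (hf : MemLp f 2 μ) :
    eLpNorm (fun p : K × K => cwt μ ψ f p.1 p.2) 2 (scaleMeasure μ) ^ 2
      = admissibilityConst χ μ ψ * eLpNorm f 2 μ ^ 2 := by
  have hg := hP.isFourierL2_fourierL2 hχ hψ.memLp
  have hφ := hP.isFourierL2_fourierL2 hχ hf
  obtain ⟨g, hg_meas, hg_eq⟩ := hg.1.1
  obtain ⟨φ, hφ_meas, hφ_eq⟩ := hφ.1.1
  have h_const : admissibilityConst χ μ ψ = ∫⁻ η, ‖g η‖ₑ ^ 2 / absVal η ∂μ :=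
    lintegral_congr_ae (hg_eq.mono fun η hη => by simp only [hη])
  rw [h_const]
  exact eLpNorm_cwt_sq_of_isFourierL2 hP hχ hψ.memLp hf (hg.congr_right hg_eq)
    (hφ.congr_right hφ_eq) hg_meas.measurable hφ_meas.measurable
    (h_const ▸ hψ.const_lt_top.ne)

theorem IsAdmissible.memLp_cwt (hψ : IsAdmissible χ μ ψ) (hP : IsPlancherel χ μ)
    (hχ : Continuous χ) (hf : MemLp f 2 μ) :
    MemLp (fun p : K × K => cwt μ ψ f p.1 p.2) 2 (scaleMeasure μ) := by
  refine ⟨(stronglyMeasurable_cwt hψ.memLp.1 hf.1).aestronglyMeasurable, ?_⟩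
  refine (ENNReal.pow_lt_top_iff.1 ?_).resolve_right two_ne_zero
  rw [hψ.eLpNorm_cwt_sq hP hχ hf]
  exact ENNReal.mul_lt_top hψ.const_lt_top (ENNReal.pow_lt_top hf.2)

end WaveletTransform

section AddSubgroupIndicator

open Fourier (fourierIntegral)

theorem setIntegral_addChar_eq_zero {G : Type*} [AddCommGroup G] [MeasurableSpace G]
    [MeasurableAdd G] {μ : Measure G} [μ.IsAddLeftInvariant] {H : AddSubgroup G}
    (hH : MeasurableSet (H : Set G)) {θ : AddChar G Circle} (hθ : ∃ y ∈ H, θ y ≠ 1) :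
    ∫ x in H, (θ x : ℂ) ∂μ = 0 := by
  obtain ⟨y, hy, hθy⟩ := hθ
  let w : G → ℂ := (H : Set G).indicator fun x => (θ x : ℂ)
  have hw (x : G) : w (y + x) = θ y * w x := by
    by_cases hx : x ∈ H <;>
      simp [w, hx, H.add_mem_cancel_left hy, AddChar.map_add_eq_mul]
  have h_shift : ∫ x, w x ∂μ = θ y * ∫ x, w x ∂μ := by
    rw [← integral_const_mul, ← integral_add_left_eq_self w y]
    simp only [hw]
  rw [← integral_indicator hH]
  exact (mul_left_eq_self₀.1 h_shift.symm).resolve_left fun h => hθy (Circle.ext (by simpa using h))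

variable {K : Type*} [CommRing K] [MeasurableSpace K] {χ : AddChar K Circle} {μ : Measure K}
  {H : AddSubgroup K}

theorem fourierIntegral_indicator_addSubgroup (hH : MeasurableSet (H : Set K)) (ξ : K) :
    fourierIntegral χ μ ((H : Set K).indicator 1) ξ
      = ∫ x in H, (χ.mulShift (-ξ) x : ℂ) ∂μ := by
  rw [fourierIntegral_eq_integral_mul, ← integral_indicator hH]
  refine integral_congr_ae (ae_of_all _ fun x => ?_)
  by_cases hx : x ∈ H <;> simp [hx, mul_comm]

theorem fourierIntegral_indicator_addSubgroup_eq_indicator [MeasurableAdd K]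
    [μ.IsAddLeftInvariant] (hH : MeasurableSet (H : Set K)) (hμ : μ H = 1)
    (hH_dual : ∀ ξ, ξ ∈ H ↔ ∀ x ∈ H, χ (ξ * x) = 1) :
    fourierIntegral χ μ ((H : Set K).indicator 1 : K → ℂ) = (H : Set K).indicator 1 := by
  ext ξ
  rw [fourierIntegral_indicator_addSubgroup hH]
  by_cases hξ : ξ ∈ H
  · have h_one : ∀ x ∈ H, (χ.mulShift (-ξ) x : ℂ) = 1 := fun x hx => by
      simp [(hH_dual ξ).1 hξ x hx, AddChar.map_neg_eq_inv]
    rw [setIntegral_congr_fun hH h_one]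
    simp [hξ, hμ, Measure.real]
  · rw [setIntegral_addChar_eq_zero hH]
    · simp [hξ]
    · have h := mt (hH_dual ξ).2 hξ
      push Not at h
      simpa [AddChar.map_neg_eq_inv] using h

end AddSubgroupIndicator

section Integers

open scoped Pointwise

variable {K : Type*} [Field K] [TopologicalSpace K] [IsTopologicalRing K] [LocallyCompactSpace K]
  {a : K} {s : Set K}

theorem absVal_le_one_of_smul_subset (hs : IsCompact s) (hs_int : (interior s).Nonempty)
    (h : a • s ⊆ s) : absVal a ≤ 1 := by
  borelize K
  rcases eq_or_ne a 0 with rfl | ha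
  · simp
  let μ : Measure K := Measure.addHaar
  have hs_pos : μ s ≠ 0 := (μ.measure_pos_of_nonempty_interior hs_int).ne'
  have h_le : absVal a * μ s ≤ 1 * μ s := by
    rw [← measure_smul_set ha, one_mul]
    exact measure_mono h
  exact_mod_cast (ENNReal.mul_le_mul_iff_left hs_pos hs.measure_lt_top.ne).1 h_le

theorem absVal_lt_one_of_smul_ssubset [T2Space K] (hs : IsCompact s) (hs_open : IsOpen s)
    (h : a • s ⊂ s) : absVal a < 1 := by
  borelize K
  rcases eq_or_ne a 0 with rfl | ha
  · simp
  let μ : Measure K := Measure.addHaar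
  have h_closed : IsClosed (a • s) := (hs.smul a).isClosed
  have h_diff : 0 < μ (s \ a • s) :=
    (hs_open.sdiff h_closed).measure_pos μ (Set.nonempty_of_ssubset h)
  have h_lt : absVal a * μ s < 1 * μ s := by
    rw [measure_sdiff h.subset h_closed.nullMeasurableSet (hs.smul a).measure_lt_top.ne] at h_diff
    rw [← measure_smul_set ha, one_mul]
    exact tsub_pos_iff_lt.1 h_diff
  exact_mod_cast lt_of_mul_lt_mul_right' h_lt

theorem mem_integers_iff_forall_char_eq_one {χ : AddChar K Circle}
    (hχ_triv : ∀ x ∈ integers K, χ x = 1) (hχ_nontriv : ∃ x ∈ primeIdealInv K, χ x ≠ 1) (ξ : K) :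
    ξ ∈ integers K ↔ ∀ x ∈ integers K, χ (ξ * x) = 1 := by
  refine ⟨fun hξ x hx => hχ_triv _ ?_, fun h => ?_⟩
  · exact (absVal_mul ξ x).trans_le (mul_le_one' hξ hx)
  · by_contra hξ
    obtain ⟨x, hx, hx_ne⟩ := hχ_nontriv
    have hξ_lt : 1 < absVal ξ := not_le.1 hξ
    have hξ_ne : ξ ≠ 0 := by
      rintro rfl
      simp at hξ_lt
    have hξ_inv : ξ⁻¹ ∈ primeIdeal K :=
      (absVal_inv ξ).trans_lt (inv_lt_one_of_one_lt₀ hξ_lt)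
    refine hx_ne ?_
    simpa [mul_left_comm ξ x, hξ_ne] using h _ (hx _ hξ_inv)

end Integers

section NonarchimedeanLocalField

open ValuativeRel
open scoped Pointwise

variable (K : Type*) [Field K] [ValuativeRel K] [TopologicalSpace K] [IsNonarchimedeanLocalField K]

/-- A compatible norm makes `K` a proper nontrivially normed field. -/
theorem t2Space_and_secondCountableTopology_and_neBot :
    T2Space K ∧ SecondCountableTopology K ∧ (𝓝[≠] (0 : K)).NeBot := by
  let := IsTopologicalAddGroup.rightUniformSpace K
  have := isUniformAddGroup_of_addCommGroup (G := K)
  let : (Valued.v (R := K)).RankOne :=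
    { hom' := IsRankLeOne.nonempty.some.emb (R := K).comp MonoidWithZeroHom.ValueGroup₀.embedding
      strictMono' := IsRankLeOne.nonempty.some.strictMono.comp
        MonoidWithZeroHom.ValueGroup₀.embedding_strictMono }
  open scoped Valued in
  have : ProperSpace K := .of_nontriviallyNormedField_of_weaklyLocallyCompactSpace K
  open scoped Valued in
  exact ⟨inferInstance, secondCountable_of_proper, inferInstance⟩

theorem t2Space_of_isNonarchimedeanLocalField : T2Space K :=
  (t2Space_and_secondCountableTopology_and_neBot K).1

theorem secondCountableTopology_of_isNonarchimedeanLocalField : SecondCountableTopology K :=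
  (t2Space_and_secondCountableTopology_and_neBot K).2.1

theorem nhdsNE_zero_neBot_of_isNonarchimedeanLocalField : (𝓝[≠] (0 : K)).NeBot :=
  (t2Space_and_secondCountableTopology_and_neBot K).2.2

attribute [local instance] t2Space_of_isNonarchimedeanLocalField
  secondCountableTopology_of_isNonarchimedeanLocalField
  nhdsNE_zero_neBot_of_isNonarchimedeanLocalField

theorem isCompact_integer : IsCompact (𝒪[K] : Set K) :=
  IsNonarchimedeanLocalField.isCompact_closedBall K 1

theorem isOpen_integer : IsOpen (𝒪[K] : Set K) := by
  let := IsTopologicalAddGroup.rightUniformSpace K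
  have := isUniformAddGroup_of_addCommGroup (G := K)
  exact Valued.isOpen_integer K

variable {K}

theorem absVal_le_one_of_valuation_le_one {x : K} (hx : valuation K x ≤ 1) : absVal x ≤ 1 := by
  refine absVal_le_one_of_smul_subset (isCompact_integer K) ?_
    (Set.smul_set_subset_iff.2 fun y hy => mul_mem hx hy)
  exact (isOpen_integer K).interior_eq.symm ▸ ⟨0, zero_mem _⟩

theorem absVal_lt_one_of_valuation_lt_one {x : K} (hx : valuation K x < 1) : absVal x < 1 := by
  refine absVal_lt_one_of_smul_ssubset (isCompact_integer K) (isOpen_integer K)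
    ⟨Set.smul_set_subset_iff.2 fun y hy => mul_mem hx.le hy, fun h => ?_⟩
  obtain ⟨y, hy, hxy⟩ := h (one_mem 𝒪[K])
  have h_lt : valuation K (x * y) < 1 := by
    rw [map_mul]
    exact mul_lt_one_of_lt_of_le hx hy
  exact h_lt.ne (by rw [show x * y = 1 from hxy, map_one])

variable (K) in
theorem integers_eq_integer : integers K = 𝒪[K] := by
  ext x
  refine ⟨fun hx => (Valuation.mem_integer_iff _ _).2 (not_lt.1 fun h => ?_),
    absVal_le_one_of_valuation_le_one⟩
  have h_inv : absVal x⁻¹ < 1 :=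
    absVal_lt_one_of_valuation_lt_one (by rw [map_inv₀]; exact inv_lt_one_of_one_lt₀ h)
  have h_prod : absVal x⁻¹ * absVal x = 1 := by
    rw [← absVal_mul, inv_mul_cancel₀, absVal_one]
    rintro rfl
    simp at h
  exact (mul_lt_one_of_lt_of_le h_inv hx).ne h_prod

theorem isPlancherel_of_char_trivial_on_integers [MeasurableSpace K] [BorelSpace K]
    {μ : Measure K} [μ.IsAddHaarMeasure] (hμ : μ (integers K) = 1) {χ : AddChar K Circle}
    (hχ : Continuous χ) (hχ_triv : ∀ x ∈ integers K, χ x = 1)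
    (hχ_nontriv : ∃ x ∈ primeIdealInv K, χ x ≠ 1) : IsPlancherel χ μ := by
  have h_dual := mem_integers_iff_forall_char_eq_one hχ_triv hχ_nontriv
  rw [integers_eq_integer] at hμ h_dual
  exact isPlancherel_of_fourierIntegral_indicator hχ (isOpen_integer K) (zero_mem 𝒪[K])
    (fourierIntegral_indicator_addSubgroup_eq_indicator (H := 𝒪[K].toAddSubgroup)
      (isOpen_integer K).measurableSet hμ h_dual)

end NonarchimedeanLocalField

end LocalFieldWavelet

open LocalFieldWavelet

theorem mainTheorem2_general {K : Type*} [Field K] [TopologicalSpace K]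
    [IsTopologicalDivisionRing K] [LocallyCompactSpace K] [T2Space K] [SecondCountableTopology K]
    [(𝓝[≠] (0 : K)).NeBot] [MeasurableSpace K] [BorelSpace K]
    (μ : Measure K) [μ.IsAddHaarMeasure] (χ : AddChar K Circle) (hχ : Continuous χ)
    (hP : IsPlancherel χ μ)
    (ψ : K → ℂ) (hψ : IsAdmissible χ μ ψ) (hψ_ne : ¬ ψ =ᵐ[μ] 0)
    (f : K → ℂ) (hf : MemLp f 2 μ) (h : K → ℂ) (hh : MemLp h 2 μ) :
    Integrable
      (fun p : K × K =>
        ∫ x, (cwt μ ψ f p.1 p.2 * daughter ψ p.1 p.2 x)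
          * conj (h x) ∂μ)
      (scaleMeasure μ) ∧
    ∫ x, f x * conj (h x) ∂μ =
      (1 / ((admissibilityConst χ μ ψ).toReal : ℂ)) *
        ∫ p : K × K,
          (∫ x, (cwt μ ψ f p.1 p.2 * daughter ψ p.1 p.2 x)
            * conj (h x) ∂μ)
          ∂(scaleMeasure μ) := by
  have hWf := hψ.memLp_cwt hP hχ hf
  have hWh := hψ.memLp_cwt hP hχ hh
  have h_const : ((admissibilityConst χ μ ψ).toReal : ℂ) ≠ 0 := by
    refine Complex.ofReal_ne_zero.2 (ENNReal.toReal_ne_zero.2 ⟨fun h_zero => hψ_ne ?_, ?_⟩)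
    · exact hP.ae_eq_zero_of_admissibilityConst_eq_zero hχ hψ.memLp h_zero
    · exact hψ.const_lt_top.ne
  have h_polarized :
      ∫ p : K × K, cwt μ ψ f p.1 p.2 * conj (cwt μ ψ h p.1 p.2) ∂(scaleMeasure μ)
        = (admissibilityConst χ μ ψ).toReal * ∫ x, f x * conj (h x) ∂μ := by
    refine integral_mul_conj_eq_of_eLpNorm_sq_eq hWf hWh hf hh fun c => ?_
    rw [← hψ.eLpNorm_cwt_sq hP hχ (hh.add (hf.const_smul c))]
    simp only [cwt_add_const_smul hψ.memLp hh hf]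
    rfl
  simp only [integral_cwt_mul_daughter_mul_conj]
  refine ⟨integrable_mul_conj hWf hWh, ?_⟩
  rw [h_polarized, one_div, inv_mul_cancel_left₀ h_const]

theorem mainTheorem2 {K : Type*} [Field K] [ValuativeRel K] [TopologicalSpace K]
    [IsNonarchimedeanLocalField K] [MeasurableSpace K] [BorelSpace K]
    (μ : Measure K) [μ.IsAddHaarMeasure] (hμ : μ (LocalFieldWavelet.integers K) = 1)
    (χ : AddChar K Circle) (hχ : Continuous χ)
    (hχ_triv : ∀ x ∈ LocalFieldWavelet.integers K, χ x = 1)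
    (hχ_nontriv : ∃ x ∈ LocalFieldWavelet.primeIdealInv K, χ x ≠ 1)
    (ψ : K → ℂ) (hψ : LocalFieldWavelet.IsAdmissible χ μ ψ) (hψ_ne : ¬ ψ =ᵐ[μ] 0)
    (f : K → ℂ) (hf : MemLp f 2 μ) (h : K → ℂ) (hh : MemLp h 2 μ) :
    Integrable
      (fun p : K × K =>
        ∫ x, (LocalFieldWavelet.cwt μ ψ f p.1 p.2 * LocalFieldWavelet.daughter ψ p.1 p.2 x)
          * conj (h x) ∂μ)
      (LocalFieldWavelet.scaleMeasure μ) ∧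
    ∫ x, f x * conj (h x) ∂μ =
      (1 / ((LocalFieldWavelet.admissibilityConst χ μ ψ).toReal : ℂ)) *
        ∫ p : K × K,
          (∫ x, (LocalFieldWavelet.cwt μ ψ f p.1 p.2 * LocalFieldWavelet.daughter ψ p.1 p.2 x)
            * conj (h x) ∂μ)
          ∂(LocalFieldWavelet.scaleMeasure μ) := by
  obtain ⟨_, _, _⟩ := t2Space_and_secondCountableTopology_and_neBot K
  exact mainTheorem2_general μ χ hχ
    (isPlancherel_of_char_trivial_on_integers hμ hχ hχ_triv hχ_nontriv) ψ hψ hψ_ne f hf h hh
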